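/- Logarithms are to base 2. Let $\mathcal X$ be a finite alphabet and let $(\mathcal X,p_X)$ be a discrete memoryless source: for each $n$, $X^n=(X_1,\dots,X_n)$ consists of i.i.d. letters of law $p_X$. A uniform compression code $\mathcal C_n$ with blocklength $n$, $M_n$ messages ($M_n$ a positive integer) and seed length $d_n\in\mathbb N$ consists of an encoder $\phi_n:\mathcal X^n\times\{1,\dots,2^{d_n}\}\to\{1,\dots,M_n\}$ and a decoder $\psi_n:\{1,\dots,M_n\}\times\{1,\dots,2^{d_n}\}\to\mathcal X^n$. With $U_{d_n}$ uniform on $\{1,\dots,2^{d_n}\}$ and independent of $X^n$, put $$\mathbf P_e(\phi_n,\psi_n)=\mathbb P\big[X^n\neq\psi_n(\phi_n(X^n,U_{d_n}),U_{d_n})\big],\qquad \mathbf U_e(\phi_n)=\sum_{m=1}^{M_n}\Big|\mathbb P[\phi_n(X^n,U_{d_n})=m]-\frac1{M_n}\Big| .$$ A sequence of such codes achieves the rate $R\in\mathbb R$ if $\lim_{n\to\infty}\frac1n\log M_n$ exists and is at most $R$, $\lim_{n\to\infty} d_n/n=0$, $\lim_{n\to\infty}\mathbf P_e(\phi_n,\psi_n)=0$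 and $\lim_{n\to\infty}\mathbf U_e(\phi_n)=0$; the rate $R$ is achievable if some sequence of codes achieves it. Let $H(X)=-\sum_x p_X(x)\log p_X(x)$. Then: 1. The infimum of the achievable rates is $H(X)$. 2. For every real sequence $(\upsilon_n)$ with $\lim_{n\to\infty}\upsilon_n=+\infty$, there is a sequence of uniform compression codes that achieves the rate $H(X)$ and whose seed length satisfies $d_n=O(\upsilon_n\sqrt n)$. 3. Suppose that $\sigma^2=\mathbb E[(\log p_X(X)+H(X))^2]>0$, i.e. that $p_X$ is not uniform on its support. Then every sequence of uniform compression codes with $\lim_{n\to\infty}\mathbf P_e(\phi_n,\psi_n)=\lim_{n\to\infty}\mathbf U_e(\phi_n)=0$ (in particular every sequence that achieves the rate $H(X)$) satisfies $\lim_{n\to\infty} d_n/\sqrt n=+\infty$. -/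

import Mathlib

open Filter Topology Asymptotics

/-- Probability of the word `x` under the `n`-fold product of `p`, i.e. `p_{X^n}(x)` for the
discrete memoryless source with single-letter law `p`. -/
noncomputable def seqProb {α : Type*} (p : PMF α) {n : ℕ} (x : Fin n → α) : ℝ :=
  ∏ i, (p (x i)).toReal

/-- Entropy `H(X)` in bits. -/
noncomputable def sourceEntropy {α : Type*} [Fintype α] (p : PMF α) : ℝ :=
  -∑ x, (p x).toReal * Real.logb 2 (p x).toReal

/-- The variance `E[(log₂ p(X) + H(X))²]` of the log-likelihood. -/
noncomputable def sourceVariance {α : Type*} [Fintype α] (p : PMF α) : ℝ :=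
  ∑ x, (p x).toReal * (Real.logb 2 (p x).toReal + sourceEntropy p) ^ 2

/-- A uniform compression code with `M` messages, blocklength `n` and a seed of `d` bits. -/
structure UniformCompressionCode (α : Type*) (M n d : ℕ) where
  /-- encoding function -/
  enc : (Fin n → α) → Fin (2 ^ d) → Fin M
  /-- decoding function -/
  dec : Fin M → Fin (2 ^ d) → (Fin n → α)

/-- Probability of the event `E (X^n, U)`, where `X^n` consists of `n` independent letters of
law `p` and `U` is uniform on a set of `2 ^ d` elements and independent of `X^n`. -/
noncomputable def jointProb {α : Type*} [Fintype α] (p : PMF α) (n d : ℕ)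
    (E : (Fin n → α) → Fin (2 ^ d) → Prop) [∀ x u, Decidable (E x u)] : ℝ :=
  ∑ x : Fin n → α, ∑ u : Fin (2 ^ d), if E x u then seqProb p x * (1 / 2 ^ d : ℝ) else 0

namespace UniformCompressionCode

variable {α : Type*} [Fintype α] [DecidableEq α] {M n d : ℕ}

/-- Average probability of error `P[X^n ≠ ψ(φ(X^n, U), U)]`. -/
noncomputable def errorProb (p : PMF α) (C : UniformCompressionCode α M n d) : ℝ :=
  jointProb p n d (fun x u => x ≠ C.dec (C.enc x u) u)

/-- The variational distance `∑ₘ |P[φ(X^n, U) = m] - 1/M|` between the law of the encoder output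
and the uniform law on the message set. -/
noncomputable def nonUniformity (p : PMF α) (C : UniformCompressionCode α M n d) : ℝ :=
  ∑ m : Fin M, |jointProb p n d (fun x u => C.enc x u = m) - 1 / (M : ℝ)|

end UniformCompressionCode

/-- The sequence of codes `C n` (with `M n` messages, blocklength `n`, seed length `d n`) achieves
the rate `R` for the source `p`. -/
def AchievesRate {α : Type*} [Fintype α] [DecidableEq α] (p : PMF α) (R : ℝ) (M d : ℕ → ℕ)
    (C : (n : ℕ) → UniformCompressionCode α (M n) n (d n)) : Prop :=
  (∃ L : ℝ, L ≤ R ∧ Tendsto (fun n : ℕ => Real.logb 2 (M n : ℝ) / (n : ℝ)) atTop (𝓝 L)) ∧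
  Tendsto (fun n : ℕ => (d n : ℝ) / (n : ℝ)) atTop (𝓝 0) ∧
  Tendsto (fun n : ℕ => (C n).errorProb p) atTop (𝓝 0) ∧
  Tendsto (fun n : ℕ => (C n).nonUniformity p) atTop (𝓝 0)

/-- The rate `R` is achievable with uniform compression codes for the source `p`. -/
def IsAchievableRate {α : Type*} [Fintype α] [DecidableEq α] (p : PMF α) (R : ℝ) : Prop :=
  ∃ (M d : ℕ → ℕ) (C : (n : ℕ) → UniformCompressionCode α (M n) n (d n)), AchievesRate p R M d C

/-! Everything is governed by the log-likelihood of the emitted word, a sum of i.i.d. terms with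
mean `-nH` and fluctuations of order `√n`.

Achievability: up to a mass controlled by Chebyshev (`wordProb_logLik_far_le`), words have
probability `2^(-nH ± t)`. They are spread greedily over about `2^(nH - 2t)` bins
(`exists_balanced_map`). One word weighs much less than a bin, so the bin is nearly uniform. A bin
holds at most `2^(3t + O(1))` typical words, and the index inside it is made exactly uniform by a
one-time pad with the seed (`binningCode`). With `t = s n * √n` and `s n → ∞` slowly, rate `H` is
achieved.

Converse: for each seed at most `M` words are decoded, so words lighter than `ε / M` are unlikely
(`wordProb_le_errorProb_add`); this already gives rate at least `H`. Near-uniformity forbids words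
heavier than `2 * 2^d / M` (`wordProb_heavy_le`). Hence the log-likelihood lies mostly in a window
of width `d + O(1)`, whereas the central limit theorem rules out windows of width `O(√n)`
(`exists_wordProb_logLik_notMem_Icc`). -/

open MeasureTheory ProbabilityTheory

/-! ### Word probabilities as finite sums -/

section WordProb

variable {α : Type*} (p : PMF α)

/-- The log-likelihood of a word. -/
noncomputable def logLik {n : ℕ} (x : Fin n → α) : ℝ :=
  ∑ i, Real.logb 2 (p (x i)).toReal

lemma seqProb_nonneg {n : ℕ} (x : Fin n → α) : 0 ≤ seqProb p x :=
  Finset.prod_nonneg fun _ _ => ENNReal.toReal_nonneg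

-- Positivity matters: since `Real.logb 2 0 = 0`, a letter of probability zero is invisible to
-- `logLik`.
variable {p} in
lemma seqProb_eq_rpow_logLik {n : ℕ} {x : Fin n → α} (hx : 0 < seqProb p x) :
    seqProb p x = 2 ^ logLik p x := by
  have h : ∀ i, 0 < (p (x i)).toReal := by
    intro i
    refine lt_of_le_of_ne ENNReal.toReal_nonneg fun h => hx.ne' ?_
    exact Finset.prod_eq_zero (Finset.mem_univ i) h.symm
  rw [logLik, seqProb, Real.rpow_sum_of_pos two_pos]
  exact Finset.prod_congr rfl fun i _ => (Real.rpow_logb two_pos (by norm_num) (h i)).symm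

variable [Fintype α]

open Classical in
/-- Probability that the word emitted by the memoryless source lies in `E`. -/
noncomputable def wordProb {n : ℕ} (E : Set (Fin n → α)) : ℝ :=
  ∑ x with x ∈ E, seqProb p x

lemma sum_toReal_eq_one : ∑ x, (p x).toReal = 1 := by
  have h := p.tsum_coe
  rw [tsum_fintype] at h
  rw [← ENNReal.toReal_sum (fun x _ => p.apply_ne_top x), h, ENNReal.toReal_one]

lemma sum_seqProb (n : ℕ) : ∑ x : Fin n → α, seqProb p x = 1 := by
  classical
  have h := Finset.prod_univ_sum (fun _ : Fin n => (Finset.univ : Finset α))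
    (fun _ x => (p x).toReal)
  simp only [sum_toReal_eq_one, Finset.prod_const_one, Fintype.piFinset_univ] at h
  exact h.symm

lemma wordProb_eq_sum_filter {n : ℕ} (E : Set (Fin n → α)) [DecidablePred (· ∈ E)] :
    wordProb p E = ∑ x with x ∈ E, seqProb p x := by
  classical
  exact Finset.sum_congr (by ext; simp) fun _ _ => rfl

lemma wordProb_nonneg {n : ℕ} (E : Set (Fin n → α)) : 0 ≤ wordProb p E :=
  Finset.sum_nonneg fun x _ => seqProb_nonneg p x

lemma wordProb_mono {n : ℕ} {E F : Set (Fin n → α)} (h : E ⊆ F) : wordProb p E ≤ wordProb p F := by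
  classical
  refine Finset.sum_le_sum_of_subset_of_nonneg ?_ fun x _ _ => seqProb_nonneg p x
  intro x hx
  simp only [Finset.mem_filter, Finset.mem_univ, true_and] at hx ⊢
  exact h hx

lemma wordProb_union_le {n : ℕ} (E F : Set (Fin n → α)) :
    wordProb p (E ∪ F) ≤ wordProb p E + wordProb p F := by
  classical
  simp only [wordProb, Finset.sum_filter, ← Finset.sum_add_distrib]
  refine Finset.sum_le_sum fun x _ => ?_
  have := seqProb_nonneg p x
  by_cases h1 : x ∈ E <;> by_cases h2 : x ∈ F <;> simp [h1, h2, this]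

lemma wordProb_add_compl {n : ℕ} (E : Set (Fin n → α)) :
    wordProb p E + wordProb p Eᶜ = 1 := by
  classical
  rw [← sum_seqProb p n]
  simp only [wordProb, Finset.sum_filter, ← Finset.sum_add_distrib]
  refine Finset.sum_congr rfl fun x _ => ?_
  by_cases h : x ∈ E <;> simp [h]

lemma wordProb_null {n : ℕ} : wordProb p {x : Fin n → α | seqProb p x = 0} = 0 := by
  classical
  refine Finset.sum_eq_zero fun x hx => ?_
  simpa using hx

lemma sourceEntropy_nonneg : 0 ≤ sourceEntropy p := by
  rw [sourceEntropy, neg_nonneg]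
  refine Finset.sum_nonpos fun x _ => mul_nonpos_of_nonneg_of_nonpos ENNReal.toReal_nonneg ?_
  refine Real.logb_nonpos one_lt_two ENNReal.toReal_nonneg ?_
  exact ENNReal.toReal_le_of_le_ofReal zero_le_one (by simpa using p.coe_le_one x)

end WordProb

/-! ### The source as an i.i.d. process -/

section LimitLaws

variable {α : Type*} (p : PMF α)

/-- The law of an infinite sequence of letters of the source. -/
noncomputable def sourceMeasure [MeasurableSpace α] : Measure (ℕ → α) :=
  Measure.infinitePi fun _ => p.toMeasure

/-- The log-likelihood of the letter at position `i`. -/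
noncomputable def letterLogLik (i : ℕ) (ω : ℕ → α) : ℝ := Real.logb 2 (p (ω i)).toReal

lemma sum_letterLogLik (n : ℕ) (ω : ℕ → α) :
    ∑ k ∈ Finset.range n, letterLogLik p k ω = logLik p (fun i : Fin n => ω i) := by
  rw [logLik, ← Fin.sum_univ_eq_sum_range (fun k => letterLogLik p k ω)]
  rfl

variable [MeasurableSpace α]

instance : IsProbabilityMeasure (sourceMeasure p) := by
  unfold sourceMeasure; infer_instance

lemma iIndepFun_eval_sourceMeasure :
    iIndepFun (fun (i : ℕ) (ω : ℕ → α) => ω i) (sourceMeasure p) :=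
  iIndepFun_infinitePi (P := fun _ : ℕ => p.toMeasure) (X := fun _ a => a) (fun _ => measurable_id)

lemma sourceMeasure_map_eval (i : ℕ) :
    (sourceMeasure p).map (fun ω => ω i) = p.toMeasure :=
  Measure.infinitePi_map_eval _ i

lemma sourceMeasure_map_prefix (n : ℕ) :
    (sourceMeasure p).map (fun ω (i : Fin n) => ω i) = Measure.pi fun _ => p.toMeasure := by
  have h := (iIndepFun_eval_sourceMeasure p).precomp (g := (Fin.val : Fin n → ℕ)) Fin.val_injective
  rw [iIndepFun_iff_map_fun_eq_pi_map (fun i => (measurable_pi_apply _).aemeasurable)] at h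
  simpa only [Function.comp_def, sourceMeasure_map_eval] using h

variable [Fintype α] [MeasurableSingletonClass α]

/-- The bridge to limit theorems: all blocklengths live on one probability space, as the central
limit theorem needs. -/
lemma wordProb_eq_sourceMeasure {n : ℕ} (E : Set (Fin n → α)) :
    wordProb p E = (sourceMeasure p).real {ω | (fun i : Fin n => ω i) ∈ E} := by
  classical
  have hm : Measurable (fun (ω : ℕ → α) (i : Fin n) => ω i) := by fun_prop
  have hE : MeasurableSet E := E.toFinite.measurableSet
  have : {ω : ℕ → α | (fun i : Fin n => ω i) ∈ E} = (fun ω (i : Fin n) => ω i) ⁻¹' E := rfl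
  rw [this, ← map_measureReal_apply hm hE, sourceMeasure_map_prefix, wordProb]
  have h2 : E = ((Finset.univ.filter (· ∈ E) : Finset (Fin n → α)) : Set (Fin n → α)) := by
    ext; simp
  conv_rhs => rw [h2]
  rw [← sum_measureReal_singleton]
  refine Finset.sum_congr (by ext; simp) fun x _ => ?_
  rw [measureReal_def, Measure.pi_singleton, ENNReal.toReal_prod, seqProb]
  refine Finset.prod_congr rfl fun i _ => ?_
  rw [PMF.toMeasure_apply_singleton _ _ (measurableSet_singleton _)]

lemma iIndepFun_letterLogLik : iIndepFun (letterLogLik p) (sourceMeasure p) :=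
  (iIndepFun_eval_sourceMeasure p).comp (fun _ a => Real.logb 2 (p a).toReal)
    (fun _ => measurable_of_finite _)

lemma measurable_letterLogLik (i : ℕ) : Measurable (letterLogLik p i) :=
  (measurable_of_finite (fun a => Real.logb 2 (p a).toReal)).comp (measurable_pi_apply i)

lemma identDistrib_letterLogLik (i : ℕ) :
    IdentDistrib (letterLogLik p i) (letterLogLik p 0) (sourceMeasure p) (sourceMeasure p) := by
  have h : IdentDistrib (fun ω : ℕ → α => ω i) (fun ω : ℕ → α => ω 0)
      (sourceMeasure p) (sourceMeasure p) :=
    ⟨(measurable_pi_apply _).aemeasurable, (measurable_pi_apply _).aemeasurable, by rw [sourceMeasure_map_eval, sourceMeasure_map_eval]⟩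
  exact h.comp (measurable_of_finite (fun a => Real.logb 2 (p a).toReal))

lemma memLp_letterLogLik (i : ℕ) : MemLp (letterLogLik p i) 2 (sourceMeasure p) := by
  obtain ⟨B, hB⟩ := (Set.finite_range fun a => ‖Real.logb 2 (p a).toReal‖).bddAbove
  refine MemLp.of_bound (measurable_letterLogLik p i).aestronglyMeasurable B (ae_of_all _ fun ω => ?_)
  exact hB ⟨ω i, rfl⟩

lemma integral_comp_eval (f : α → ℝ) (i : ℕ) :
    ∫ ω, f (ω i) ∂(sourceMeasure p) = ∑ x, (p x).toReal * f x := by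
  have h := integral_map (μ := sourceMeasure p) (φ := fun ω => ω i) (f := f)
    (measurable_pi_apply i).aemeasurable (measurable_of_finite f).aestronglyMeasurable
  rw [← h, sourceMeasure_map_eval, PMF.integral_eq_sum]
  simp

lemma integral_letterLogLik (i : ℕ) :
    ∫ ω, letterLogLik p i ω ∂(sourceMeasure p) = - sourceEntropy p := by
  simpa [sourceEntropy, letterLogLik] using
    integral_comp_eval p (fun a => Real.logb 2 (p a).toReal) i

lemma variance_letterLogLik (i : ℕ) :
    Var[letterLogLik p i; sourceMeasure p] = sourceVariance p := by
  rw [variance_eq_integral (measurable_letterLogLik p i).aemeasurable, integral_letterLogLik]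
  simpa [sourceVariance, letterLogLik] using
    integral_comp_eval p (fun a => (Real.logb 2 (p a).toReal + sourceEntropy p) ^ 2) i

end LimitLaws

/-! ### Concentration and anti-concentration of the log-likelihood -/

section Concentration

variable {α : Type*} [Fintype α] (p : PMF α)

/-- Chebyshev's inequality for the log-likelihood of a word. -/
lemma wordProb_logLik_far_le (n : ℕ) {t : ℝ} (ht : 0 < t) :
    wordProb p {x : Fin n → α | t ≤ |logLik p x + n * sourceEntropy p|} ≤
      n * sourceVariance p / t ^ 2 := by
  let _ : MeasurableSpace α := ⊤
  have : MeasurableSingletonClass α := ⟨fun _ => trivial⟩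
  have hL : ∀ i ∈ Finset.range n, MemLp (letterLogLik p i) 2 (sourceMeasure p) :=
    fun i _ => memLp_letterLogLik p i
  have hv : Var[∑ k ∈ Finset.range n, letterLogLik p k; sourceMeasure p] =
      n * sourceVariance p := by
    rw [IndepFun.variance_sum hL
      fun i _ j _ hij => (iIndepFun_letterLogLik p).indepFun hij]
    simp [variance_letterLogLik]
  have he : ∫ ω, (∑ k ∈ Finset.range n, letterLogLik p k) ω ∂(sourceMeasure p) =
      - (n * sourceEntropy p) := by
    simp only [Finset.sum_apply]
    rw [integral_finsetSum _ fun i hi => (hL i hi).integrable (by norm_num)]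
    simp [integral_letterLogLik]
  have hc := meas_ge_le_variance_div_sq (memLp_finsetSum' _ hL) ht
  rw [he, hv] at hc
  rw [wordProb_eq_sourceMeasure, measureReal_def]
  have h0 : 0 ≤ n * sourceVariance p / t ^ 2 := by
    rw [← hv]; exact div_nonneg (variance_nonneg _ _) (sq_nonneg _)
  refine ENNReal.toReal_le_of_le_ofReal h0 (le_trans (measure_mono ?_) hc)
  intro ω hω
  simpa [sum_letterLogLik] using hω

/-- By the central limit theorem, the normalized log-likelihood visits any nonempty open set with
probability bounded away from `0`. -/
lemma exists_wordProb_tail_lower_bound (hσ : 0 < sourceVariance p) {G : Set ℝ}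
    (hG : IsOpen G) (hne : G.Nonempty) :
    ∃ δ > 0, ∀ᶠ n : ℕ in atTop,
      δ ≤ wordProb p {x : Fin n → α | (√(n : ℝ))⁻¹ * (logLik p x + n * sourceEntropy p) ∈ G} := by
  let _ : MeasurableSpace α := ⊤
  have : MeasurableSingletonClass α := ⟨fun _ => trivial⟩
  have hY : HasLaw (id : ℝ → ℝ)
      (gaussianReal 0 Var[letterLogLik p 0; sourceMeasure p].toNNReal)
      (gaussianReal 0 Var[letterLogLik p 0; sourceMeasure p].toNNReal) := HasLaw.id
  have clt := tendstoInDistribution_inv_sqrt_mul_sum_sub hY (memLp_letterLogLik p 0)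
    (iIndepFun_letterLogLik p) (identDistrib_letterLogLik p)
  have h := ProbabilityMeasure.le_liminf_measure_open_of_tendsto clt.tendsto hG
  simp only [ProbabilityMeasure.coe_mk, Measure.map_id, variance_letterLogLik] at h
  have hv : (sourceVariance p).toNNReal ≠ 0 := by simpa using hσ
  -- Lebesgue measure is absolutely continuous with respect to a nondegenerate Gaussian, so the
  -- latter charges `G`.
  have hpos : 0 < gaussianReal 0 (sourceVariance p).toNNReal G := by
    rw [pos_iff_ne_zero]
    intro h0
    exact (hG.measure_pos volume hne).ne' (gaussianReal_absolutelyContinuous' 0 hv h0)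
  obtain ⟨δ, hδ0, hδ⟩ := ENNReal.lt_iff_exists_nnreal_btwn.1 hpos
  refine ⟨δ, by simpa using hδ0, ?_⟩
  filter_upwards [eventually_lt_of_lt_liminf (hδ.trans_le h)] with n hn
  rw [wordProb_eq_sourceMeasure, measureReal_def]
  rw [Measure.map_apply_of_aemeasurable (clt.forall_aemeasurable n) hG.measurableSet] at hn
  rw [← ENNReal.coe_toReal]
  refine ENNReal.toReal_mono (measure_ne_top _ _) (hn.le.trans (measure_mono fun ω hω => ?_))
  simpa [sum_letterLogLik, integral_letterLogLik] using hω

/-- The log-likelihood does not concentrate on any interval of length `O(√n)`. -/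
lemma exists_wordProb_logLik_notMem_Icc (hσ : 0 < sourceVariance p) (c : ℝ) :
    ∃ δ > 0, ∀ᶠ n : ℕ in atTop, ∀ a : ℝ,
      δ ≤ wordProb p {x : Fin n → α | logLik p x ∉ Set.Icc a (a + c * √(n : ℝ))} := by
  obtain ⟨δ₁, h₁, e₁⟩ := exists_wordProb_tail_lower_bound p hσ (isOpen_Ioi (a := c))
    Set.nonempty_Ioi
  obtain ⟨δ₂, h₂, e₂⟩ := exists_wordProb_tail_lower_bound p hσ (isOpen_Iio (a := 0))
    Set.nonempty_Iio
  refine ⟨min δ₁ δ₂, lt_min h₁ h₂, ?_⟩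
  filter_upwards [e₁, e₂, eventually_gt_atTop 0] with n h₁ h₂ hn a
  have hs : 0 < √(n : ℝ) := Real.sqrt_pos.2 (by exact_mod_cast hn)
  -- A window starting below the mean misses the upper tail beyond `c * √n`; one starting above it
  -- misses the lower half. The bound is thus uniform in `a`.
  rcases le_total a (-(n * sourceEntropy p)) with ha | ha
  · refine (min_le_left _ _).trans (h₁.trans (wordProb_mono p fun x hx hx' => ?_))
    simp only [Set.mem_ofPred_eq, Set.mem_Ioi, inv_mul_eq_div, lt_div_iff₀ hs] at hx
    linarith [hx'.2]
  · refine (min_le_right _ _).trans (h₂.trans (wordProb_mono p fun x hx hx' => ?_))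
    simp only [Set.mem_ofPred_eq, Set.mem_Iio, inv_mul_eq_div, div_lt_iff₀ hs] at hx
    linarith [hx'.1]

end Concentration

/-! ### One-shot bounds for codes -/

section Codes

variable {α : Type*} [Fintype α] (p : PMF α)

lemma jointProb_eq_average {n d : ℕ} (E : (Fin n → α) → Fin (2 ^ d) → Prop)
    [∀ x u, Decidable (E x u)] :
    jointProb p n d E = (∑ u, wordProb p {x | E x u}) / 2 ^ d := by
  classical
  rw [jointProb, Finset.sum_comm, Finset.sum_div]
  refine Finset.sum_congr rfl fun u _ => ?_
  rw [wordProb, Finset.sum_filter, Finset.sum_div]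
  refine Finset.sum_congr rfl fun x _ => ?_
  by_cases h : E x u
  · simp [h]; ring
  · simp [h]

variable {M n d : ℕ}

namespace UniformCompressionCode

lemma messages_pos {α : Type*} [Nonempty α] {M n d : ℕ} (C : UniformCompressionCode α M n d) :
    0 < M := by
  have x : Fin n → α := fun _ => Classical.arbitrary α
  exact Fin.pos (C.enc x ⟨0, by positivity⟩)

variable (C : UniformCompressionCode α M n d)

/-- A word of probability above `2 * 2 ^ d / M` is always encoded into a message whose probability
is more than twice the uniform one. -/
lemma wordProb_heavy_le :
    wordProb p {x : Fin n → α | 2 * 2 ^ d / (M : ℝ) < seqProb p x} ≤ 2 * C.nonUniformity p := by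
  classical
  have : Nonempty α := ⟨p.support_nonempty.some⟩
  have hM : (0 : ℝ) < M := by exact_mod_cast C.messages_pos
  have h2 : (0 : ℝ) < 2 ^ d := by positivity
  set Q : Fin M → ℝ := fun m => jointProb p n d (fun x u => C.enc x u = m) with hQ
  have hnn : ∀ x u m, 0 ≤ if C.enc x u = m then seqProb p x * (1 / 2 ^ d : ℝ) else 0 := by
    intro x u m
    have := seqProb_nonneg p x
    split_ifs <;> positivity
  -- The single pair `(x, u)` already contributes `seqProb p x / 2 ^ d` to its message.
  have hheavy : ∀ x ∈ {x : Fin n → α | 2 * 2 ^ d / (M : ℝ) < seqProb p x}, ∀ u,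
      2 / (M : ℝ) < Q (C.enc x u) := by
    intro x hx u
    have h1 : 2 / (M : ℝ) < seqProb p x * (1 / 2 ^ d) := by
      rw [mul_one_div, lt_div_iff₀ h2]
      calc 2 / (M : ℝ) * 2 ^ d = 2 * 2 ^ d / (M : ℝ) := by ring
        _ < _ := hx
    refine h1.trans_le ?_
    have h3 := Finset.single_le_sum (fun v _ => hnn x v (C.enc x u)) (Finset.mem_univ u)
    have h4 := Finset.single_le_sum (f := fun y => ∑ v, if C.enc y v = C.enc x u then
      seqProb p y * (1 / 2 ^ d : ℝ) else 0) (fun y _ => Finset.sum_nonneg fun v _ =>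
        hnn y v (C.enc x u)) (Finset.mem_univ x)
    simp only [if_true] at h3
    exact h3.trans h4
  -- If `Q m > 2 / M`, more than half of `Q m` is excess over `1 / M`.
  have hupper : ∑ m with 2 / (M : ℝ) < Q m, Q m ≤ 2 * C.nonUniformity p := by
    rw [nonUniformity, Finset.mul_sum]
    refine (Finset.sum_le_sum fun m hm => ?_).trans
      (Finset.sum_le_sum_of_subset_of_nonneg (Finset.filter_subset _ _)
        fun m _ _ => by positivity)
    have h1 := (Finset.mem_filter.1 hm).2
    have h3 : 2 / (M : ℝ) = 2 * (1 / M) := by ring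
    have h4 := le_abs_self (Q m - 1 / (M : ℝ))
    change Q m ≤ 2 * |Q m - 1 / (M : ℝ)|
    linarith
  refine le_trans ?_ hupper
  simp only [hQ, jointProb]
  rw [Finset.sum_comm, wordProb]
  refine (Finset.sum_le_sum fun x hx => ?_).trans
    (Finset.sum_le_sum_of_subset_of_nonneg (Finset.filter_subset _ _)
      fun x _ _ => Finset.sum_nonneg fun m _ => Finset.sum_nonneg fun u _ => hnn x u m)
  have hx' := hheavy x (Finset.mem_filter.1 hx).2
  rw [Finset.sum_comm]
  have h5 : ∀ u ∈ (Finset.univ : Finset (Fin (2 ^ d))), seqProb p x * (1 / 2 ^ d : ℝ) ≤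
      ∑ m with 2 / (M : ℝ) < Q m, if C.enc x u = m then seqProb p x * (1 / 2 ^ d : ℝ) else 0 := by
    intro u _
    rw [Finset.sum_ite_eq, if_pos (by simpa using hx' u)]
  refine le_trans (le_of_eq ?_) (Finset.sum_le_sum h5)
  simp
  field_simp

variable [DecidableEq α]

/-- At most `M` words per seed are decoded correctly, so a set of words of probability at most `b`
each that is much larger than `M` cannot be likely. -/
lemma wordProb_le_errorProb_add {E : Set (Fin n → α)} {b : ℝ} (hb : 0 ≤ b)
    (hE : ∀ x ∈ E, seqProb p x ≤ b) : wordProb p E ≤ C.errorProb p + M * b := by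
  classical
  have key : ∀ u, wordProb p E ≤ wordProb p {x | x ≠ C.dec (C.enc x u) u} + M * b := by
    intro u
    set G : Set (Fin n → α) := {x | x ∈ E ∧ x = C.dec (C.enc x u) u} with hG
    have hsub : E ⊆ {x | x ≠ C.dec (C.enc x u) u} ∪ G := by
      intro x hx
      by_cases h : x = C.dec (C.enc x u) u
      · exact Or.inr ⟨hx, h⟩
      · exact Or.inl h
    refine (wordProb_mono p hsub).trans ((wordProb_union_le p _ _).trans ?_)
    gcongr
    rw [wordProb_eq_sum_filter]
    refine (Finset.sum_le_card_nsmul _ _ b fun x hx => hE x ?_).trans ?_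
    · exact (Finset.mem_filter.1 hx).2.1
    · rw [nsmul_eq_mul]
      gcongr
      -- With the seed fixed, a correctly decoded word is determined by its message.
      have hc := Finset.card_le_card_of_injOn (s := Finset.univ.filter (· ∈ G))
        (t := (Finset.univ : Finset (Fin M))) (fun x => C.enc x u) (by simp) ?_
      · simpa using hc
      · intro x hx y hy hxy
        have hx' : x ∈ G := by simpa using hx
        have hy' : y ∈ G := by simpa using hy
        have hxy' : C.enc x u = C.enc y u := hxy
        rw [hx'.2, hy'.2, hxy']
  rw [errorProb, jointProb_eq_average]
  have h2 : (0 : ℝ) < 2 ^ d := by positivity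
  have hs := Finset.sum_le_sum fun (u : Fin (2 ^ d)) (_ : u ∈ Finset.univ) => key u
  simp only [Finset.sum_add_distrib, Finset.sum_const, Finset.card_univ, Fintype.card_fin,
    nsmul_eq_mul] at hs
  push_cast at hs
  rw [div_add' _ _ _ h2.ne', le_div_iff₀ h2]
  linarith

end UniformCompressionCode

/-! ### Binning with an encrypted index -/

/-- Greedy balancing: weights of total at most `1`, each at most `a`, can be distributed among `K`
bins such that no bin receives more than `1 / K + a`. -/
lemma exists_balanced_map {ι : Type*} [DecidableEq ι] (w : ι → ℝ) {a : ℝ} (ha : 0 ≤ a) {K : ℕ}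
    (hK : 0 < K) (s : Finset ι) (hwa : ∀ i ∈ s, w i ≤ a) (hw : ∀ i ∈ s, 0 ≤ w i)
    (hs : ∑ i ∈ s, w i ≤ 1) :
    ∃ f : ι → Fin K, ∀ k, ∑ i ∈ s with f i = k, w i ≤ 1 / K + a := by
  have hK' : (0 : ℝ) < K := by exact_mod_cast hK
  induction s using Finset.induction_on with
  | empty => exact ⟨fun _ => ⟨0, hK⟩, fun k => by simp; positivity⟩
  | insert x s hx ih =>
    rw [Finset.sum_insert hx] at hs
    have hwx := hw x (Finset.mem_insert_self _ _)
    obtain ⟨f, hf⟩ := ih (fun i hi => hwa i (Finset.mem_insert_of_mem hi))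
      (fun i hi => hw i (Finset.mem_insert_of_mem hi)) (by linarith)
    -- Pigeonhole: if every bin exceeded `1 / K`, the total would exceed `1`. The new item goes into
    -- `k₀`.
    obtain ⟨k₀, hk₀⟩ : ∃ k₀, ∑ i ∈ s with f i = k₀, w i ≤ 1 / K := by
      by_contra! h
      have h1 := Finset.sum_lt_sum_of_nonempty (s := (Finset.univ : Finset (Fin K)))
        ⟨⟨0, hK⟩, Finset.mem_univ _⟩ fun k _ => h k
      rw [Finset.sum_fiberwise] at h1
      simp only [Finset.sum_const, Finset.card_univ, Fintype.card_fin, nsmul_eq_mul] at h1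
      rw [mul_one_div_cancel hK'.ne'] at h1
      linarith
    refine ⟨Function.update f x k₀, fun k => ?_⟩
    have hsame : ∀ k, s.filter (fun i => Function.update f x k₀ i = k) =
        s.filter (fun i => f i = k) := fun k => by
      refine Finset.filter_congr fun i hi => ?_
      rw [Function.update_of_ne (by rintro rfl; exact hx hi)]
    rw [Finset.filter_insert, Function.update_self, hsame]
    split_ifs with h
    · rw [Finset.sum_insert (by simp [hx]), ← h]
      linarith [hwa x (Finset.mem_insert_self _ _)]
    · exact hf k

variable {K : ℕ} (f : (Fin n → α) → Fin K) (g : (Fin n → α) → Fin (2 ^ d)) 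
  (A : Set (Fin n → α))

lemma sum_wordProb_fiber (E : Set (Fin n → α)) :
    ∑ k, wordProb p {x | f x = k ∧ x ∈ E} = wordProb p E := by
  classical
  simp only [wordProb, Finset.sum_filter]
  rw [Finset.sum_comm]
  refine Finset.sum_congr rfl fun x _ => ?_
  by_cases h : x ∈ E <;> simp [h]

/-- The deviations sum to zero, so upper bounds suffice: `|z| ≤ 2 * c - z` whenever `z ≤ c` and `0 ≤
c`, and the `z` cancel on summation. -/
lemma sum_abs_wordProb_fiber_sub_le (hK : 0 < K) {a : ℝ} (ha : 0 ≤ a)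
    (hf : ∀ k, wordProb p {x | f x = k ∧ x ∈ A} ≤ 1 / K + a) :
    ∑ k, |wordProb p {x | f x = k} - 1 / (K : ℝ)| ≤ 2 * (K * a + wordProb p Aᶜ) := by
  classical
  have hK' : (0 : ℝ) < K := by exact_mod_cast hK
  have hone : ∑ k, wordProb p {x | f x = k} = 1 := by
    have h := sum_wordProb_fiber p f Set.univ
    have h1 := wordProb_add_compl p (Set.univ : Set (Fin n → α))
    have h3 : wordProb p (∅ : Set (Fin n → α)) = 0 := by simp [wordProb]
    rw [Set.compl_univ, h3, add_zero] at h1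
    simpa [h1] using h
  have hk : ∀ k ∈ (Finset.univ : Finset (Fin K)), |wordProb p {x | f x = k} - 1 / (K : ℝ)| ≤
      2 * (a + wordProb p {x | f x = k ∧ x ∈ Aᶜ}) - (wordProb p {x | f x = k} - 1 / (K : ℝ)) := by
    intro k _
    have h0 := wordProb_nonneg p {x | f x = k ∧ x ∈ Aᶜ}
    have hsub : {x | f x = k} ⊆ {x | f x = k ∧ x ∈ A} ∪ {x | f x = k ∧ x ∈ Aᶜ} := by
      intro x hx
      by_cases h : x ∈ A
      · exact Or.inl ⟨hx, h⟩
      · exact Or.inr ⟨hx, h⟩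
    have h1 := (wordProb_mono p hsub).trans (wordProb_union_le p _ _)
    have h3 := hf k
    rw [abs_le]
    constructor <;> linarith
  refine (Finset.sum_le_sum hk).trans (le_of_eq ?_)
  rw [Finset.sum_sub_distrib, ← Finset.mul_sum, Finset.sum_add_distrib, Finset.sum_sub_distrib,
    hone, sum_wordProb_fiber]
  simp only [Finset.sum_const, Finset.card_univ, Fintype.card_fin, nsmul_eq_mul]
  rw [mul_one_div_cancel hK'.ne']
  ring

/-- The code that sends a word `x` to its bin `f x` together with its index `g x` in that bin,
encrypted by the seed. Words of `A` are decoded correctly. -/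
noncomputable def binningCode [Nonempty (Fin n → α)] :
    UniformCompressionCode α (K * 2 ^ d) n d where
  -- Addition in `Fin (2 ^ d)` is modular, which makes this a one-time pad.
  enc x u := finProdFinEquiv (f x, g x + u)
  dec m u := Function.invFunOn (fun x => finProdFinEquiv (f x, g x + u)) A m

variable [Nonempty (Fin n → α)]

/-- For each word and each `j`, exactly one seed encrypts the index to `j`. The encrypted index is
therefore uniform and independent of the bin, and only the bins contribute. -/
lemma nonUniformity_binningCode :
    (binningCode f g A).nonUniformity p = ∑ k, |wordProb p {x | f x = k} - 1 / (K : ℝ)| := by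
  classical
  have h2 : (0 : ℝ) < 2 ^ d := by positivity
  rw [UniformCompressionCode.nonUniformity, ← finProdFinEquiv.sum_comp, Fintype.sum_prod_type]
  refine Finset.sum_congr rfl fun k _ => ?_
  have h : ∀ j : Fin (2 ^ d), |jointProb p n d (fun x u => (binningCode f g A).enc x u =
      finProdFinEquiv (k, j)) - 1 / ((K * 2 ^ d : ℕ) : ℝ)| =
      |wordProb p {x | f x = k} - 1 / (K : ℝ)| / 2 ^ d := by
    intro j
    have hj : jointProb p n d (fun x u => (binningCode f g A).enc x u =
        finProdFinEquiv (k, j)) = wordProb p {x | f x = k} / 2 ^ d := by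
      rw [jointProb, wordProb, Finset.sum_filter, Finset.sum_div]
      refine Finset.sum_congr rfl fun x _ => ?_
      have h1 : ∀ u, (binningCode f g A).enc x u = finProdFinEquiv (k, j) ↔
          f x = k ∧ u = j - g x := by
        intro u
        simp only [binningCode, EmbeddingLike.apply_eq_iff_eq, Prod.mk.injEq]
        rw [eq_sub_iff_add_eq, add_comm u]
      simp only [h1]
      by_cases hk : f x = k
      · simp [hk]; ring
      · simp [hk]
    rw [hj, ← abs_of_pos h2, ← abs_div, abs_of_pos h2]
    congr 1
    push_cast
    rw [sub_div, div_div]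
  simp only [h, Finset.sum_const, Finset.card_univ, Fintype.card_fin, nsmul_eq_mul]
  push_cast
  field_simp

variable [DecidableEq α]

lemma errorProb_binningCode_le (hg : ∀ x ∈ A, ∀ y ∈ A, f x = f y → g x = g y → x = y) :
    (binningCode f g A).errorProb p ≤ wordProb p Aᶜ := by
  rw [UniformCompressionCode.errorProb, jointProb_eq_average, div_le_iff₀ (by positivity)]
  have h : ∀ u ∈ (Finset.univ : Finset (Fin (2 ^ d))), wordProb p {x | x ≠ (binningCode f g A).dec
      ((binningCode f g A).enc x u) u} ≤ wordProb p Aᶜ := by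
    intro u _
    refine wordProb_mono p fun x hx hxA => hx ?_
    have hinj : Set.InjOn (fun x => finProdFinEquiv (f x, g x + u)) A := by
      intro x hx y hy hxy
      have h1 := finProdFinEquiv.injective hxy
      simp only [Prod.mk.injEq, add_left_inj] at h1
      exact hg x hx y hy h1.1 h1.2
    exact (hinj.leftInvOn_invFunOn hxA).symm
  refine (Finset.sum_le_card_nsmul _ _ _ h).trans (le_of_eq ?_)
  simp [mul_comm]

/-- One-shot achievability. -/
lemma exists_uniformCompressionCode (hK : 0 < K) {a b : ℝ} (ha : 0 ≤ a) (hb : 0 < b)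
    (hAa : ∀ x ∈ A, seqProb p x ≤ a) (hAb : ∀ x ∈ A, b ≤ seqProb p x)
    (hd : 1 / (K : ℝ) + a ≤ 2 ^ d * b) :
    ∃ C : UniformCompressionCode α (K * 2 ^ d) n d,
      C.errorProb p ≤ wordProb p Aᶜ ∧
      C.nonUniformity p ≤ 2 * (K * a + wordProb p Aᶜ) ∧ (K = 1 → C.nonUniformity p = 0) := by
  classical
  obtain ⟨f, hf⟩ := exists_balanced_map (seqProb p) ha hK (Finset.univ.filter (· ∈ A))
    (fun x hx => hAa x (by simpa using hx)) (fun x _ => seqProb_nonneg p x)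
    ((Finset.sum_le_sum_of_subset_of_nonneg (Finset.filter_subset _ _)
      fun x _ _ => seqProb_nonneg p x).trans (sum_seqProb p n).le)
  have hfw : ∀ k, wordProb p {x | f x = k ∧ x ∈ A} ≤ 1 / K + a := by
    intro k
    refine le_trans (le_of_eq ?_) (hf k)
    rw [wordProb]
    refine Finset.sum_congr ?_ fun _ _ => rfl
    ext x
    simp [and_comm]
  -- A bin of mass at most `2 ^ d * b`, whose words in `A` weigh at least `b` each, has at most `2 ^
  -- d` of them to index.
  have hcard : ∀ k, ∃ g : (Fin n → α) → Fin (2 ^ d), Set.InjOn g {x | f x = k ∧ x ∈ A} := by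
    intro k
    have h1 : ((Finset.univ.filter (fun x => f x = k ∧ x ∈ A)).card : ℝ) * b ≤ 2 ^ d * b := by
      refine le_trans ?_ ((hfw k).trans hd)
      rw [wordProb, ← nsmul_eq_mul]
      refine le_trans (Finset.card_nsmul_le_sum _ _ b fun x hx => hAb x ?_)
        (le_of_eq (Finset.sum_congr ?_ fun _ _ => rfl))
      · exact (Finset.mem_filter.1 hx).2.2
      · ext x; simp
    have h2 := le_of_mul_le_mul_right h1 hb
    have h3 : (Finset.univ.filter (fun x => f x = k ∧ x ∈ A)).card ≤ 2 ^ d := by exact_mod_cast h2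
    obtain ⟨g, -, hg⟩ := Set.Finite.exists_injOn_of_encard_le (s := {x | f x = k ∧ x ∈ A})
      (t := (Set.univ : Set (Fin (2 ^ d)))) (Set.toFinite _) (by
        rw [← Finset.coe_filter_univ, Set.encard_coe_eq_coe_finsetCard]
        simp only [Set.encard_univ, ENat.card_eq_coe_fintype_card, Fintype.card_fin]
        exact_mod_cast h3)
    exact ⟨g, hg⟩
  choose g hg using hcard
  refine ⟨binningCode f (fun x => g (f x) x) A, ?_, ?_, ?_⟩
  · refine errorProb_binningCode_le p f _ A fun x hx y hy hxy h => ?_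
    refine hg (f x) ⟨rfl, hx⟩ ⟨hxy.symm, hy⟩ ?_
    rw [h, hxy]
  · rw [nonUniformity_binningCode]
    exact sum_abs_wordProb_fiber_sub_le p f A hK ha hfw
  · rintro rfl
    rw [nonUniformity_binningCode]
    refine Finset.sum_eq_zero fun k _ => ?_
    have h1 : {x | f x = k} = Set.univ := by
      ext x; simp [Subsingleton.elim (f x) k]
    have h2 : wordProb p (Set.univ : Set (Fin n → α)) = 1 := by
      simpa [wordProb] using sum_seqProb p n
    simp [h1, h2]

end Codes

/-! ### Asymptotic converse and achievability -/

section Asymptotics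

variable {α : Type*} [Fintype α] (p : PMF α)

lemma tendsto_two_rpow_neg {ι : Type*} {l : Filter ι} {t : ι → ℝ} (ht : Tendsto t l atTop) :
    Tendsto (fun i => (2 : ℝ) ^ (-t i)) l (𝓝 0) :=
  (tendsto_rpow_atBot_of_base_gt_one 2 one_lt_two).comp (tendsto_neg_atTop_atBot.comp ht)

/-- Number of bins for blocklength `n` and slack `t` around the entropy. -/
noncomputable def binCount (n : ℕ) (t : ℝ) : ℕ := ⌈(2 : ℝ) ^ (n * sourceEntropy p - 2 * t)⌉₊

/-- Seed length for the slack `t` around the entropy. -/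
noncomputable def seedLength (t : ℝ) : ℕ := ⌈3 * t⌉₊ + 1

lemma binCount_pos (n : ℕ) (t : ℝ) : 0 < binCount p n t :=
  Nat.ceil_pos.2 (Real.rpow_pos_of_pos two_pos _)

lemma le_logb_binCount (n : ℕ) (t : ℝ) :
    n * sourceEntropy p - 2 * t ≤ Real.logb 2 (binCount p n t) := by
  rw [Real.le_logb_iff_rpow_le one_lt_two (by exact_mod_cast binCount_pos p n t)]
  exact Nat.le_ceil _

lemma logb_binCount_le (n : ℕ) {t : ℝ} (ht : 0 ≤ t) :
    Real.logb 2 (binCount p n t) ≤ n * sourceEntropy p + 1 := by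
  have hH : 0 ≤ n * sourceEntropy p := mul_nonneg n.cast_nonneg (sourceEntropy_nonneg p)
  rw [Real.logb_le_iff_le_rpow one_lt_two (by exact_mod_cast binCount_pos p n t),
    Real.rpow_add two_pos, Real.rpow_one]
  have h1 : (binCount p n t : ℝ) < 2 ^ (n * sourceEntropy p - 2 * t) + 1 :=
    Nat.ceil_lt_add_one (Real.rpow_nonneg two_pos.le _)
  have h2 : (2 : ℝ) ^ (n * sourceEntropy p - 2 * t) ≤ 2 ^ (n * sourceEntropy p) :=
    Real.rpow_le_rpow_of_exponent_le one_le_two (by linarith)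
  have h3 := Real.one_le_rpow one_le_two hH
  linarith

variable [DecidableEq α]

/-- Converse: no achievable rate lies below the entropy. -/
lemma sourceEntropy_le_of_achievesRate {R : ℝ} {M d : ℕ → ℕ}
    {C : (n : ℕ) → UniformCompressionCode α (M n) n (d n)} (h : AchievesRate p R M d C) :
    sourceEntropy p ≤ R := by
  obtain ⟨⟨L, hLR, hL⟩, -, hP, -⟩ := h
  refine le_trans ?_ hLR
  by_contra! hlt
  have : Nonempty α := ⟨p.support_nonempty.some⟩
  set H := sourceEntropy p with hH
  -- One third of the gap each for the convergence of the rate, the decay of `M n * b`, and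
  -- Chebyshev.
  obtain ⟨η, hη, hη3⟩ : ∃ η > 0, H - L = 3 * η := ⟨(H - L) / 3, by linarith, by ring⟩
  have hbound : ∀ᶠ n : ℕ in atTop, 1 ≤ (C n).errorProb p + 2 ^ (-((n : ℝ) * η)) +
      sourceVariance p / η ^ 2 / (n : ℝ) := by
    filter_upwards [hL.eventually_lt_const (show L < L + η by linarith), eventually_gt_atTop 0]
      with n hn hn0
    have hn' : (0 : ℝ) < n := by exact_mod_cast hn0
    have hM : (0 : ℝ) < M n := by exact_mod_cast (C n).messages_pos
    set E : Set (Fin n → α) := {x | seqProb p x ≤ 2 ^ (-((n : ℝ) * (H - η)))} with hE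
    have h1 := (C n).wordProb_le_errorProb_add p (E := E) (Real.rpow_nonneg two_pos.le _)
      fun x hx => hx
    have h2 := wordProb_add_compl p E
    have h3 : wordProb p Eᶜ ≤ sourceVariance p / η ^ 2 / (n : ℝ) := by
      refine (wordProb_mono p fun x hx => ?_).trans
        ((wordProb_logLik_far_le p n (mul_pos hn' hη)).trans (le_of_eq (by field_simp)))
      have hx1 : (2 : ℝ) ^ (-((n : ℝ) * (H - η))) < seqProb p x := not_le.1 hx
      rw [seqProb_eq_rpow_logLik (lt_trans (Real.rpow_pos_of_pos two_pos _) hx1),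
        Real.rpow_lt_rpow_left_iff one_lt_two] at hx1
      have h4 := le_abs_self (logLik p x + n * H)
      change (n : ℝ) * η ≤ |logLik p x + n * H|
      linarith
    have h4 : (M n : ℝ) * 2 ^ (-((n : ℝ) * (H - η))) ≤ 2 ^ (-((n : ℝ) * η)) := by
      rw [div_lt_iff₀ hn', Real.logb_lt_iff_lt_rpow one_lt_two hM] at hn
      refine (mul_le_mul_of_nonneg_right hn.le (Real.rpow_nonneg two_pos.le _)).trans ?_
      rw [← Real.rpow_add two_pos]
      refine le_of_eq (congrArg _ ?_)
      linear_combination (-(n : ℝ)) * hη3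
    linarith
  have hlim : Tendsto (fun n : ℕ => (C n).errorProb p + 2 ^ (-((n : ℝ) * η)) +
      sourceVariance p / η ^ 2 / (n : ℝ)) atTop (𝓝 (0 + 0 + 0)) :=
    (hP.add (tendsto_two_rpow_neg (tendsto_natCast_atTop_atTop.atTop_mul_const hη))).add
      (tendsto_const_div_atTop_nhds_zero_nat _)
  have := ge_of_tendsto hlim hbound
  norm_num at this

/-- Converse for the seed length. -/
lemma tendsto_seedLength_div_sqrt (hσ : 0 < sourceVariance p) {M d : ℕ → ℕ}
    {C : (n : ℕ) → UniformCompressionCode α (M n) n (d n)}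
    (hP : Tendsto (fun n : ℕ => (C n).errorProb p) atTop (𝓝 0))
    (hU : Tendsto (fun n : ℕ => (C n).nonUniformity p) atTop (𝓝 0)) :
    Tendsto (fun n : ℕ => (d n : ℝ) / √(n : ℝ)) atTop atTop := by
  have : Nonempty α := ⟨p.support_nonempty.some⟩
  refine tendsto_atTop.2 fun c => ?_
  -- The extra `√n` absorbs the constant `1 - Real.logb 2 ε` in the window width. With `ε = δ / 4`,
  -- the mass outside the window is below `2 * ε` (light words) plus `ε` (heavy words), hence below
  -- `δ`.
  obtain ⟨δ, hδ, hspread⟩ := exists_wordProb_logLik_notMem_Icc p hσ (c + 1)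
  set ε := δ / 4 with hεδ
  have hε : 0 < ε := by positivity
  have hsqrt : Tendsto (fun n : ℕ => √(n : ℝ)) atTop atTop :=
    Real.tendsto_sqrt_atTop.comp tendsto_natCast_atTop_atTop
  filter_upwards [hspread, hP.eventually_lt_const hε,
    hU.eventually_lt_const (show 0 < ε / 2 by positivity), eventually_gt_atTop 0,
    hsqrt.eventually_ge_atTop (1 - Real.logb 2 ε)] with n hn hPn hUn hn0 hlarge
  by_contra! hlt
  have hs : 0 < √(n : ℝ) := Real.sqrt_pos.2 (by exact_mod_cast hn0)
  have hM : (0 : ℝ) < M n := by exact_mod_cast (C n).messages_pos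
  rw [div_lt_iff₀ hs] at hlt
  have hlight := (C n).wordProb_le_errorProb_add p (E := {x | seqProb p x ≤ ε / (M n : ℝ)})
    (by positivity) fun x hx => hx
  rw [mul_div_cancel₀ _ hM.ne'] at hlight
  have hheavy := (C n).wordProb_heavy_le p
  have hcover : {x : Fin n → α | logLik p x ∉ Set.Icc (Real.logb 2 ε - Real.logb 2 (M n))
      (Real.logb 2 ε - Real.logb 2 (M n) + (c + 1) * √(n : ℝ))} ⊆
      {x | seqProb p x ≤ ε / (M n : ℝ)} ∪ {x | 2 * 2 ^ d n / (M n : ℝ) < seqProb p x} := by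
    intro x hx
    by_contra hnot
    simp only [Set.mem_union, Set.mem_ofPred_eq, not_or, not_le, not_lt] at hnot
    obtain ⟨hlo, hhi⟩ := hnot
    have hpos : 0 < seqProb p x := lt_trans (by positivity) hlo
    have hlog : Real.logb 2 (seqProb p x) = logLik p x := by
      conv_lhs => rw [seqProb_eq_rpow_logLik hpos]
      exact Real.logb_rpow two_pos (by norm_num)
    refine hx ⟨?_, ?_⟩
    · rw [← hlog, ← Real.logb_div hε.ne' hM.ne']
      exact Real.logb_le_logb_of_le one_lt_two (by positivity) hlo.le
    · have h1 := Real.logb_le_logb_of_le one_lt_two hpos hhi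
      rw [hlog, Real.logb_div (by positivity) hM.ne', Real.logb_mul (by norm_num) (by positivity),
        Real.logb_self_eq_one one_lt_two, Real.logb_pow, Real.logb_self_eq_one one_lt_two] at h1
      linarith
  have h := (hn _).trans ((wordProb_mono p hcover).trans (wordProb_union_le p _ _))
  linarith

/-- With `K ≈ 2^(nH - 2t)` bins and typical words of mass at most `a = 2^(-nH + t)`, the imbalance
`K * a` is about `2^(-t)`. -/
lemma exists_code_of_slack (n : ℕ) {t : ℝ} (ht : 0 ≤ t) :
    ∃ C : UniformCompressionCode α (binCount p n t * 2 ^ seedLength t) n (seedLength t),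
      C.errorProb p ≤ wordProb p {x : Fin n → α | t ≤ |logLik p x + n * sourceEntropy p|} ∧
      C.nonUniformity p ≤ 2 * (2 * 2 ^ (-t) +
        wordProb p {x : Fin n → α | t ≤ |logLik p x + n * sourceEntropy p|}) := by
  have : Nonempty α := ⟨p.support_nonempty.some⟩
  set H := sourceEntropy p
  set F : Set (Fin n → α) := {x | t ≤ |logLik p x + n * H|} with hF
  set A : Set (Fin n → α) := {x | 0 < seqProb p x ∧ |logLik p x + n * H| < t} with hA
  have hAc : wordProb p Aᶜ ≤ wordProb p F := by
    have hsub : Aᶜ ⊆ {x : Fin n → α | seqProb p x = 0} ∪ F := by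
      intro x hx
      rcases (seqProb_nonneg p x).eq_or_lt with h0 | h0
      · exact Or.inl h0.symm
      · exact Or.inr (not_lt.1 fun h => hx ⟨h0, h⟩)
    refine (wordProb_mono p hsub).trans ((wordProb_union_le p _ _).trans ?_)
    rw [wordProb_null, zero_add]
  have hKpos : (0 : ℝ) < binCount p n t := by exact_mod_cast binCount_pos p n t
  have hKle : (2 : ℝ) ^ (n * H - 2 * t) ≤ binCount p n t := Nat.le_ceil _
  have hd : 1 / (binCount p n t : ℝ) + 2 ^ (-(n * H) + t) ≤
      2 ^ seedLength t * 2 ^ (-(n * H) - t) := by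
    have h1 : 1 / (binCount p n t : ℝ) ≤ 2 ^ (-(n * H) + 2 * t) := by
      refine (one_div_le_one_div_of_le (Real.rpow_pos_of_pos two_pos _) hKle).trans (le_of_eq ?_)
      rw [one_div, ← Real.rpow_neg two_pos.le]
      congr 1
      ring
    have h2 : (2 : ℝ) ^ (-(n * H) + t) ≤ 2 ^ (-(n * H) + 2 * t) :=
      Real.rpow_le_rpow_of_exponent_le one_le_two (by linarith)
    -- Bin mass over the least typical word mass is `2^(3t + 1)`, whence the choice of `seedLength`.
    have h3 : (2 : ℝ) * 2 ^ (-(n * H) + 2 * t) ≤ 2 ^ seedLength t * 2 ^ (-(n * H) - t) := by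
      rw [← Real.rpow_natCast, ← Real.rpow_add two_pos]
      nth_rewrite 1 [← Real.rpow_one 2]
      rw [← Real.rpow_add two_pos]
      refine Real.rpow_le_rpow_of_exponent_le one_le_two ?_
      have := Nat.le_ceil (3 * t)
      rw [seedLength]
      push_cast
      linarith
    linarith
  obtain ⟨C, hP, hU, hU1⟩ := exists_uniformCompressionCode p A (binCount_pos p n t)
    (Real.rpow_nonneg two_pos.le (-(n * H) + t)) (Real.rpow_pos_of_pos two_pos (-(n * H) - t))
    (fun x hx => by
      rw [seqProb_eq_rpow_logLik hx.1]
      refine Real.rpow_le_rpow_of_exponent_le one_le_two ?_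
      linarith [(abs_lt.1 hx.2).2])
    (fun x hx => by
      rw [seqProb_eq_rpow_logLik hx.1]
      refine Real.rpow_le_rpow_of_exponent_le one_le_two ?_
      linarith [(abs_lt.1 hx.2).1]) hd
  refine ⟨C, hP.trans hAc, ?_⟩
  have hFnn := wordProb_nonneg p F
  have htpos := Real.rpow_pos_of_pos two_pos (-t)
  -- For a nonpositive exponent the ceiling gives a single bin, where `K * a` need not be small but
  -- the code is exactly uniform.
  rcases le_or_gt (n * H - 2 * t) 0 with hexp | hexp
  · rw [hU1 ?_]
    · positivity
    · refine le_antisymm (Nat.ceil_le.2 ?_) (binCount_pos p n t)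
      simpa using Real.rpow_le_one_of_one_le_of_nonpos one_le_two hexp
  · refine hU.trans ?_
    have h1 : (binCount p n t : ℝ) ≤ 2 * 2 ^ (n * H - 2 * t) := by
      have h2 := Nat.ceil_lt_add_one (Real.rpow_nonneg two_pos.le (n * H - 2 * t))
      have h3 := Real.one_le_rpow one_le_two hexp.le
      have h4 : (binCount p n t : ℝ) < 2 ^ (n * H - 2 * t) + 1 := h2
      linarith
    have h2 : (binCount p n t : ℝ) * 2 ^ (-(n * H) + t) ≤ 2 * 2 ^ (-t) := by
      refine (mul_le_mul_of_nonneg_right h1 (Real.rpow_nonneg two_pos.le _)).trans (le_of_eq ?_)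
      rw [mul_assoc, ← Real.rpow_add two_pos]
      congr 2
      ring
    linarith

/-- Achievability, for a slack `s n * √n` with `s n` growing more slowly than `√n`. -/
lemma exists_achievesRate_sourceEntropy {s : ℕ → ℝ} (hs0 : ∀ n, 0 ≤ s n)
    (hs : Tendsto s atTop atTop) (hsn : Tendsto (fun n : ℕ => s n * √(n : ℝ) / n) atTop (𝓝 0)) :
    ∃ C : (n : ℕ) → UniformCompressionCode α (binCount p n (s n * √(n : ℝ)) *
        2 ^ seedLength (s n * √(n : ℝ))) n (seedLength (s n * √(n : ℝ))),
      AchievesRate p (sourceEntropy p) _ _ C := by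
  have ht : ∀ n : ℕ, 0 ≤ s n * √(n : ℝ) := fun n => mul_nonneg (hs0 n) (Real.sqrt_nonneg _)
  choose C hP hU using fun n : ℕ => exists_code_of_slack p n (ht n)
  have hsqrt : Tendsto (fun n : ℕ => √(n : ℝ)) atTop atTop :=
    Real.tendsto_sqrt_atTop.comp tendsto_natCast_atTop_atTop
  have hfar : Tendsto (fun n : ℕ => wordProb p
      {x : Fin n → α | s n * √(n : ℝ) ≤ |logLik p x + n * sourceEntropy p|}) atTop (𝓝 0) := by
    have hlim : Tendsto (fun n => sourceVariance p / s n ^ 2) atTop (𝓝 0) :=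
      ((tendsto_pow_atTop two_ne_zero).comp hs).const_div_atTop _
    refine squeeze_zero' (Eventually.of_forall fun n => wordProb_nonneg p _) ?_ hlim
    filter_upwards [hs.eventually_gt_atTop 0, eventually_gt_atTop 0] with n hsn hn
    have hn' : (0 : ℝ) < n := by exact_mod_cast hn
    refine (wordProb_logLik_far_le p n (mul_pos hsn (Real.sqrt_pos.2 hn'))).trans (le_of_eq ?_)
    rw [mul_pow, Real.sq_sqrt hn'.le]
    field_simp
  have herr : Tendsto (fun n => (C n).errorProb p) atTop (𝓝 0) :=
    squeeze_zero (fun n => by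
      rw [UniformCompressionCode.errorProb, jointProb_eq_average]
      exact div_nonneg (Finset.sum_nonneg fun u _ => wordProb_nonneg p _) (by positivity)) hP hfar
  have hunif : Tendsto (fun n => (C n).nonUniformity p) atTop (𝓝 0) := by
    refine squeeze_zero (fun n => Finset.sum_nonneg fun m _ => abs_nonneg _) hU ?_
    have h := (((tendsto_two_rpow_neg (hs.atTop_mul_atTop₀ hsqrt)).const_mul 2).add
      hfar).const_mul 2
    simpa using h
  have hseed : ∀ n : ℕ, (seedLength (s n * √(n : ℝ)) : ℝ) ≤ 3 * (s n * √(n : ℝ)) + 2 := by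
    intro n
    have h := Nat.ceil_lt_add_one (mul_nonneg (zero_le_three (α := ℝ)) (ht n))
    rw [seedLength]
    push_cast
    linarith
  have hupper : Tendsto (fun n : ℕ => 3 * (s n * √(n : ℝ) / n) + 3 / (n : ℝ)) atTop (𝓝 0) := by
    simpa using (hsn.const_mul 3).add (tendsto_const_div_atTop_nhds_zero_nat 3)
  refine ⟨C, ⟨sourceEntropy p, le_rfl, ?_⟩, ?_, herr, hunif⟩
  · have hlog : ∀ n : ℕ, Real.logb 2 ((binCount p n (s n * √(n : ℝ)) *
        2 ^ seedLength (s n * √(n : ℝ)) : ℕ) : ℝ) =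
        Real.logb 2 (binCount p n (s n * √(n : ℝ))) + seedLength (s n * √(n : ℝ)) := by
      intro n
      have := binCount_pos p n (s n * √(n : ℝ))
      push_cast
      rw [Real.logb_mul (by positivity) (by positivity), Real.logb_pow,
        Real.logb_self_eq_one one_lt_two, mul_one]
    have hlo : Tendsto (fun n : ℕ => sourceEntropy p - 2 * (s n * √(n : ℝ) / n)) atTop
        (𝓝 (sourceEntropy p)) := by
      simpa using tendsto_const_nhds.sub (hsn.const_mul 2)
    have hhi : Tendsto (fun n : ℕ => sourceEntropy p + (3 * (s n * √(n : ℝ) / n) + 3 / (n : ℝ)))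
        atTop (𝓝 (sourceEntropy p)) := by
      simpa using tendsto_const_nhds.add hupper
    refine tendsto_of_tendsto_of_tendsto_of_le_of_le' hlo hhi ?_ ?_
    · filter_upwards [eventually_gt_atTop 0] with n hn
      have hn' : (0 : ℝ) < n := by exact_mod_cast hn
      rw [hlog, le_div_iff₀ hn', sub_mul, mul_assoc, div_mul_cancel₀ _ hn'.ne']
      have h1 := le_logb_binCount p n (s n * √(n : ℝ))
      have h2 : (0 : ℝ) ≤ seedLength (s n * √(n : ℝ)) := Nat.cast_nonneg _
      linarith
    · filter_upwards [eventually_gt_atTop 0] with n hn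
      have hn' : (0 : ℝ) < n := by exact_mod_cast hn
      rw [hlog, div_le_iff₀ hn', add_mul, add_mul, mul_assoc 3, div_mul_cancel₀ _ hn'.ne',
        div_mul_cancel₀ _ hn'.ne']
      linarith [logb_binCount_le p n (ht n), hseed n]
  · refine squeeze_zero' (Eventually.of_forall fun n => by positivity) ?_ hupper
    filter_upwards [eventually_gt_atTop 0] with n hn
    have hn' : (0 : ℝ) < n := by exact_mod_cast hn
    rw [div_le_iff₀ hn', add_mul, mul_assoc 3, div_mul_cancel₀ _ hn'.ne',
        div_mul_cancel₀ _ hn'.ne']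
    linarith [hseed n]

/-- Achievability of the entropy with a seed length in `O(υ n * √n)`. -/
lemma exists_achievesRate_seedLength_isBigO {υ : ℕ → ℝ} (hυ : Tendsto υ atTop atTop) :
    ∃ (M d : ℕ → ℕ) (C : (n : ℕ) → UniformCompressionCode α (M n) n (d n)),
      AchievesRate p (sourceEntropy p) M d C ∧
      (fun n : ℕ => (d n : ℝ)) =O[atTop] (fun n : ℕ => υ n * √(n : ℝ)) := by
  have hsqrt : Tendsto (fun n : ℕ => √(n : ℝ)) atTop atTop :=
    Real.tendsto_sqrt_atTop.comp tendsto_natCast_atTop_atTop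
  have hsqrt2 : Tendsto (fun n : ℕ => √√(n : ℝ)) atTop atTop := Real.tendsto_sqrt_atTop.comp hsqrt
  -- The cap `n^(1/4)` keeps `s n * √n` in `o(n)` however fast `υ` grows; the `max` handles negative
  -- initial terms.
  set s : ℕ → ℝ := fun n => min (max (υ n) 0) (√√(n : ℝ)) with hs_def
  have hs0 : ∀ n, 0 ≤ s n := fun n => le_min (le_max_right _ _) (Real.sqrt_nonneg _)
  have hs : Tendsto s atTop atTop := by
    rw [tendsto_atTop]
    intro b
    filter_upwards [hυ.eventually_ge_atTop b, hsqrt2.eventually_ge_atTop b] with n h1 h2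
    exact le_min (h1.trans (le_max_left _ _)) h2
  have hsn : Tendsto (fun n : ℕ => s n * √(n : ℝ) / n) atTop (𝓝 0) := by
    refine squeeze_zero' (Eventually.of_forall fun n => div_nonneg
      (mul_nonneg (hs0 n) (Real.sqrt_nonneg _)) n.cast_nonneg) ?_ hsqrt2.inv_tendsto_atTop
    filter_upwards [eventually_gt_atTop 0] with n hn
    have hn' : (0 : ℝ) < n := by exact_mod_cast hn
    have hq : 0 < √√(n : ℝ) := Real.sqrt_pos.2 (Real.sqrt_pos.2 hn')
    have h1 : √√(n : ℝ) * √√(n : ℝ) = √(n : ℝ) := Real.mul_self_sqrt (Real.sqrt_nonneg _)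
    have h2 : √(n : ℝ) * √(n : ℝ) = n := Real.mul_self_sqrt hn'.le
    rw [div_le_iff₀ hn', Pi.inv_apply, inv_mul_eq_div, le_div_iff₀ hq]
    calc s n * √(n : ℝ) * √√(n : ℝ) ≤ √√(n : ℝ) * √(n : ℝ) * √√(n : ℝ) := by
          gcongr; exact min_le_right _ _
      _ = n := by rw [mul_right_comm, h1, h2]
  obtain ⟨C, hC⟩ := exists_achievesRate_sourceEntropy p hs0 hs hsn
  -- `5 = 3 + 2`: the seed length is at most `3 * (s n * √n) + 2`, and eventually `1 ≤ υ n * √n`.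
  refine ⟨_, _, C, hC, IsBigO.of_bound 5 ?_⟩
  filter_upwards [hυ.eventually_ge_atTop 1, hsqrt.eventually_ge_atTop 1] with n h1 h2
  have h3 := Nat.ceil_lt_add_one (mul_nonneg (zero_le_three (α := ℝ))
    (mul_nonneg (hs0 n) (Real.sqrt_nonneg (n : ℝ))))
  have h4 : s n * √(n : ℝ) ≤ υ n * √(n : ℝ) := by
    gcongr
    refine (min_le_left _ _).trans (le_of_eq (max_eq_left (by linarith)))
  have h5 : 1 ≤ υ n * √(n : ℝ) := one_le_mul_of_one_le_of_one_le h1 h2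
  rw [Real.norm_of_nonneg (Nat.cast_nonneg _), Real.norm_of_nonneg (by linarith), seedLength]
  push_cast
  linarith

end Asymptotics

theorem proposition2 {α : Type*} [Fintype α] [DecidableEq α] (p : PMF α) :
    IsGLB {R : ℝ | IsAchievableRate p R} (sourceEntropy p) ∧
    (∀ υ : ℕ → ℝ, Tendsto υ atTop atTop →
      ∃ (M d : ℕ → ℕ) (C : (n : ℕ) → UniformCompressionCode α (M n) n (d n)),
        AchievesRate p (sourceEntropy p) M d C ∧
        (fun n : ℕ => (d n : ℝ)) =O[atTop] (fun n : ℕ => υ n * √(n : ℝ))) ∧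
    (0 < sourceVariance p →
      ∀ (M d : ℕ → ℕ) (C : (n : ℕ) → UniformCompressionCode α (M n) n (d n)),
        Tendsto (fun n : ℕ => (C n).errorProb p) atTop (𝓝 0) →
        Tendsto (fun n : ℕ => (C n).nonUniformity p) atTop (𝓝 0) →
        Tendsto (fun n : ℕ => (d n : ℝ) / √(n : ℝ)) atTop atTop) := by

  refine ⟨⟨?_, ?_⟩, fun υ hυ => exists_achievesRate_seedLength_isBigO p hυ,
    fun hσ M d C hP hU => tendsto_seedLength_div_sqrt p hσ hP hU⟩
  · rintro R ⟨M, d, C, hC⟩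
    exact sourceEntropy_le_of_achievesRate p hC
  · intro b hb
    -- Any divergent `υ` would do: the entropy is itself achievable, so the infimum is attained.
    obtain ⟨M, d, C, hC, -⟩ := exists_achievesRate_seedLength_isBigO p tendsto_natCast_atTop_atTop
    exact hb ⟨M, d, C, hC⟩
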